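/- Digraphs are finite and may have loops and parallel edges; a cycle is a path of positive length that returns to its start. A coloring assigns a color to every edge; it is deterministic if no vertex has two outgoing edges of the same color. For a deterministic coloring of a digraph $\Gamma$ and a word $s$ over the colors, write $ps$ for the end of the path that starts at the vertex $p$ and is consecutively labelled by $s$, if this path exists. Say that $s$ acts on $\Gamma$ if $ps$ exists for every vertex $p$, and then let $\Gamma s=\{ps : p \text{ a vertex of } \Gamma\}$. The coloring is $k$-synchronizing if it is deterministic and some nonempty word $s$ that acts on $\Gamma$ satisfies $|\Gamma s|=k$, while $|\Gamma t|\ge k$ for every word $t$ that acts on $\Gamma$. Lemma. Let $\Gamma$ be a finite digraph with sink component $\Gamma_1$: a strongly connected component that no edge leaves and that can be reached by a path from every vertex of $\Gamma$. Suppose that by removing some (possibly no) edges of $\Gamma_1$, and no vertices, one obtains a strongly connected digraph $\Gamma_2$ in which every vertex has the same outdegree $d\ge 1$. Let $k$ be the greatest common divisor of the lengths of the cycles of $\Gamma_2$. Then $\Gamma_2$ has a $k$-synchronizing coloring with $d$ colors, and every $k$-synchronizing coloring of $\Gamma_2$ with $d$ colors extends to a $k$-synchronizing coloring of $\Gamma$,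 in which the remaining edges may have any of these $d$ colors or additional ones. In particular, $\Gamma$ has a $k$-synchronizing coloring. -/

import Mathlib

/-- A directed graph with vertices `V` and edges `E`; loops and parallel edges are allowed. -/
structure MultiDigraph (V E : Type*) where
  /-- the vertex an edge leaves -/
  src : E → V
  /-- the vertex an edge enters -/
  tgt : E → V

namespace MultiDigraph

/-- `Γ.IsPath p l q`: the edges in the list `l` form, in this order, a path from `p` to `q`
(vertices and edges may repeat; the empty list is the path of length zero from `p` to `p`). -/
def IsPath {V E : Type*} (Γ : MultiDigraph V E) : V → List E → V → Prop
  | p, [], q => p = q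
  | p, e :: l, q => Γ.src e = p ∧ Γ.IsPath (Γ.tgt e) l q

/-- There is a path (possibly of length zero) from `p` to `q`. -/
def Reachable {V E : Type*} (Γ : MultiDigraph V E) (p q : V) : Prop :=
  ∃ l : List E, Γ.IsPath p l q

/-- The graph has a vertex, and there is a path from every vertex to every vertex. -/
def StronglyConnected {V E : Type*} (Γ : MultiDigraph V E) : Prop :=
  Nonempty V ∧ ∀ p q : V, Γ.Reachable p q

/-- Every vertex has exactly `d` outgoing edges. -/
def HasUniformOutdegree {V E : Type*} (Γ : MultiDigraph V E) (d : ℕ) : Prop :=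
  ∀ p : V, {e : E | Γ.src e = p}.encard = d

/-- The lengths of the cycles, a cycle being a path of positive length that returns to its
start. -/
def cycleLengths {V E : Type*} (Γ : MultiDigraph V E) : Set ℕ :=
  {n | ∃ (p : V) (l : List E), l ≠ [] ∧ Γ.IsPath p l p ∧ l.length = n}

/-- The greatest common divisor of the lengths of all cycles. -/
noncomputable def cycleGcd {V E : Type*} (Γ : MultiDigraph V E) : ℕ :=
  Nat.setGcd Γ.cycleLengths

/-- The subgraph with vertex set `S` and edge set `F`. -/
def subgraph {V E : Type*} (Γ : MultiDigraph V E) (S : Set V) (F : Set E)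
    (h : ∀ e ∈ F, Γ.src e ∈ S ∧ Γ.tgt e ∈ S) : MultiDigraph S F where
  src e := ⟨Γ.src e, (h e e.2).1⟩
  tgt e := ⟨Γ.tgt e, (h e e.2).2⟩

/-- `S` is the vertex set of a strongly connected component, i.e. a class of mutually reachable
vertices. -/
def IsComponent {V E : Type*} (Γ : MultiDigraph V E) (S : Set V) : Prop :=
  ∃ p : V, S = {q | Γ.Reachable p q ∧ Γ.Reachable q p}

/-- `S` is the vertex set of the sink component: a strongly connected component that no edge
leaves and into which a path leads from every vertex of the graph. -/
def IsSinkComponent {V E : Type*} (Γ : MultiDigraph V E) (S : Set V) : Prop :=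
  Γ.IsComponent S ∧ (∀ e : E, Γ.src e ∈ S → Γ.tgt e ∈ S) ∧
    ∀ p : V, ∃ q ∈ S, Γ.Reachable p q

/-- The coloring `c` of the edges turns the graph into a deterministic automaton: no vertex has
two outgoing edges of the same color. (The automaton need not be complete.) -/
def Deterministic {V E C : Type*} (Γ : MultiDigraph V E) (c : E → C) : Prop :=
  ∀ e f : E, Γ.src e = Γ.src f → c e = c f → e = f

/-- `q = p s`: some path from `p` to `q` is consecutively labelled by the letters of `s`. -/
def Run {V E C : Type*} (Γ : MultiDigraph V E) (c : E → C) (p : V) (s : List C) (q : V) : Prop :=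
  ∃ l : List E, Γ.IsPath p l q ∧ l.map c = s

/-- The word `s` is a map of the state set: `p s` exists for every state `p`. -/
def Acts {V E C : Type*} (Γ : MultiDigraph V E) (c : E → C) (s : List C) : Prop :=
  ∀ p : V, ∃ q : V, Γ.Run c p s q

/-- `Γ s`, the image of the set of all states under the word `s`. -/
def image {V E C : Type*} (Γ : MultiDigraph V E) (c : E → C) (s : List C) : Set V :=
  {q | ∃ p : V, Γ.Run c p s q}

/-- The nonempty word `s` acts on the states with `|Γ s| = k`, and `|Γ t| ≥ k` for all words `t`
that act on the states. -/
def IsSynchronizingWord {V E C : Type*} (Γ : MultiDigraph V E) (c : E → C) (k : ℕ)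
    (s : List C) : Prop :=
  s ≠ [] ∧ Γ.Acts c s ∧ (Γ.image c s).encard = k ∧
    ∀ t : List C, Γ.Acts c t → (k : ℕ∞) ≤ (Γ.image c t).encard

/-- `c` is a `k`-synchronizing coloring. -/
def IsSynchronizingColoring {V E C : Type*} (Γ : MultiDigraph V E) (c : E → C) (k : ℕ) : Prop :=
  Γ.Deterministic c ∧ ∃ s : List C, Γ.IsSynchronizingWord c k s

end MultiDigraph

/-! Existence of a coloring of the subgraph is the periodic road coloring theorem. A path of length
`n` shifts the residue classes of the vertices modulo `k` by `n`, so every word that acts leaves at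
least `k` states (`cycleGcd_le_encard_image`). For the upper bound, a coloring is viewed as a
complete automaton, and two states are stable if they can be merged after every word. Stability is a
congruence, and recolorings of the quotient lift without increase of rank
(`exists_ncard_wordImage_liftRecolor_le`). By induction on the number of states it is enough to find
a recoloring with a nontrivial stable pair, unless every state has only one successor; then the
graph is a single cycle.

The stable pair comes from Trahtman's idea: choose one edge at every state such that the deepest
vertices of the resulting functional graph all enter the cycles at the same point
(`exists_choice_hasUniqueDeepRoot`). A choice with the most vertices on cycles is improved by
redirecting one or two edges. If these edges carry one letter, its powers turn a suitable minimal
image into two minimal images that differ in one element, and the two elements concerned are stable.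

For the extension, one edge towards the sink at every outer vertex gets the old color 0, and every
other new edge a color of its own. Powers of 0 drive all vertices into the sink, where old words act
as before. A fresh color can be read at one state only, so a word containing it acts only if the
prefix before it has already merged all states, which forces `k ≤ 1`. -/

namespace RoadColoring

/-! ### Functional graphs and the redirection of one edge -/

section FunctionalGraph

open Function

variable {Q : Type*} {f : Q → Q}

theorem iterate_mem_periodicPts {x : Q} (hx : x ∈ periodicPts f) (n : ℕ) :
    f^[n] x ∈ periodicPts f := by
  obtain ⟨m, hm, h⟩ := hx
  exact ⟨m, hm, h.apply_iterate n⟩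

theorem iterate_mem_periodicPts_of_le {x : Q} {m n : ℕ} (hx : f^[m] x ∈ periodicPts f)
    (h : m ≤ n) : f^[n] x ∈ periodicPts f := by
  obtain ⟨t, rfl⟩ := Nat.exists_eq_add_of_le' h
  rw [iterate_add_apply]
  exact iterate_mem_periodicPts hx t

/-- A point on a cycle is reached from every point of its orbit. -/
theorem exists_iterate_iterate_eq {x : Q} (hx : x ∈ periodicPts f) (n : ℕ) :
    ∃ m, f^[m] (f^[n] x) = x := by
  obtain ⟨p, hp, h⟩ := hx
  have hle : n ≤ p * n := Nat.le_mul_of_pos_left n hp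
  refine ⟨p * n - n, ?_⟩
  rw [← iterate_add_apply, Nat.sub_add_cancel hle]
  exact h.mul_const n

theorem exists_iterate_add_eq [Finite Q] (f : Q → Q) : ∃ i N, 0 < N ∧ f^[i + N] = f^[i] := by
  obtain ⟨a, b, hab, h⟩ := Finite.exists_ne_map_eq_of_infinite (fun n : ℕ => f^[n])
  rcases Nat.lt_or_gt_of_ne hab with hlt | hlt
  · exact ⟨a, b - a, by omega, by rw [Nat.add_sub_cancel' hlt.le]; exact h.symm⟩
  · exact ⟨b, a - b, by omega, by rw [Nat.add_sub_cancel' hlt.le]; exact h⟩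

theorem exists_iterate_mem_periodicPts [Finite Q] (f : Q → Q) :
    ∃ i, ∀ x, f^[i] x ∈ periodicPts f := by
  obtain ⟨i, N, hN, h⟩ := exists_iterate_add_eq f
  refine ⟨i, fun x => ⟨N, hN, ?_⟩⟩
  rw [IsPeriodicPt, IsFixedPt, ← iterate_add_apply, Nat.add_comm, h]

/-- The eventual period of the iterates serves, because a point on a cycle is itself an `i`-th
iterate. -/
theorem exists_common_period [Finite Q] (f : Q → Q) :
    ∃ N, 0 < N ∧ ∀ x ∈ periodicPts f, f^[N] x = x := by
  obtain ⟨i, N, hN, h⟩ := exists_iterate_add_eq f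
  refine ⟨N, hN, fun x hx => ?_⟩
  obtain ⟨m, hm⟩ := exists_iterate_iterate_eq hx i
  rw [← iterate_add_apply, Nat.add_comm, iterate_add_apply] at hm
  conv_lhs => rw [← hm, ← iterate_add_apply, Nat.add_comm, h]
  exact hm

/-- The first point on a cycle in the orbit of `x`. -/
theorem exists_first_periodic [Finite Q] (f : Q → Q) (x : Q) :
    ∃ j, f^[j] x ∈ periodicPts f ∧ ∀ t < j, f^[t] x ∉ periodicPts f := by
  classical
  obtain ⟨i, hi⟩ := exists_iterate_mem_periodicPts f
  have h : ∃ j, f^[j] x ∈ periodicPts f := ⟨i, hi x⟩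
  exact ⟨Nat.find h, Nat.find_spec h, fun t ht => Nat.find_min h ht⟩

/-- The first time the orbit of `x` meets `b`. -/
theorem exists_first_hit {x b : Q} (h : ∃ i, f^[i] x = b) :
    ∃ i, f^[i] x = b ∧ ∀ t < i, f^[t] x ≠ b := by
  classical
  exact ⟨Nat.find h, Nat.find_spec h, fun t ht => Nat.find_min h ht⟩

section Update

variable [DecidableEq Q] {b c : Q}

theorem iterate_update_of_avoid {x : Q} {n : ℕ} (h : ∀ i < n, f^[i] x ≠ b) :
    (update f b c)^[n] x = f^[n] x := by
  induction n with
  | zero => rfl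
  | succ n ih =>
    rw [iterate_succ_apply', iterate_succ_apply', ih fun i hi => h i (by omega),
      update_of_ne (h n (by omega))]

theorem mem_periodicPts_update_iff {x : Q} (h : ∀ i, f^[i] x ≠ b) :
    x ∈ periodicPts (update f b c) ↔ x ∈ periodicPts f := by
  simp only [mem_periodicPts, IsPeriodicPt, IsFixedPt,
    iterate_update_of_avoid (c := c) fun i _ => h i]

end Update

/-- All points at sufficiently large distance from the cycles of `f`, of which there is at least
one, enter the set of points on cycles at the same point `r`. -/
def HasUniqueDeepRoot (f : Q → Q) : Prop :=
  ∃ n, ∃ r ∈ periodicPts f, (∃ v, f^[n] v ∉ periodicPts f) ∧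
    ∀ v, f^[n] v ∉ periodicPts f → ∃ m, f^[m] v ∉ periodicPts f ∧ f^[m + 1] v = r

/-- Take `n + 1` to be the maximal depth: a vertex still off the cycles at time `n` enters them at
the very next step, hence at the common root. -/
theorem HasUniqueDeepRoot.exists_max [Finite Q] (h : HasUniqueDeepRoot f) :
    ∃ n, (∃ v, f^[n] v ∉ periodicPts f) ∧ (∀ v, f^[n + 1] v ∈ periodicPts f) ∧
      ∀ u v, f^[n] u ∉ periodicPts f → f^[n] v ∉ periodicPts f → f^[n + 1] u = f^[n + 1] v := by
  classical
  obtain ⟨n, r, hr, ⟨v₀, hv₀⟩, hroot⟩ := h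
  obtain ⟨i, hi⟩ := exists_iterate_mem_periodicPts f
  have hex : ∃ t, ∀ v, f^[t] v ∈ periodicPts f := ⟨i, hi⟩
  set M := Nat.find hex with hM
  have hMs := Nat.find_spec hex
  have hnM : n < M := by
    by_contra hlt
    exact hv₀ (iterate_mem_periodicPts_of_le (hMs v₀) (by omega))
  have hMpred : ∃ v, f^[M - 1] v ∉ periodicPts f := by
    have := Nat.find_min hex (m := M - 1) (by omega)
    push Not at this
    exact this
  have key : ∀ v, f^[M - 1] v ∉ periodicPts f → f^[M - 1 + 1] v = r := by
    intro v hv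
    obtain ⟨m, hm, hmr⟩ := hroot v fun h => hv (iterate_mem_periodicPts_of_le h (by omega))
    have h1 : m < M := by
      by_contra hlt
      exact hm (iterate_mem_periodicPts_of_le (hMs v) (by omega))
    have h2 : ¬ m + 1 ≤ M - 1 := fun hle =>
      hv (iterate_mem_periodicPts_of_le (hmr ▸ hr) hle)
    rwa [show M - 1 = m by omega]
  refine ⟨M - 1, hMpred, fun v => ?_, fun u v hu hv => (key u hu).trans (key v hv).symm⟩
  rw [Nat.sub_add_cancel (by omega)]
  exact hMs v

theorem iterate_ne_iterate_of_lt {b : Q} {s t : ℕ} (hs : 1 ≤ s) (hst : s < t)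
    (ht : t ≤ minimalPeriod f b) : f^[s] b ≠ f^[t] b := by
  intro h
  have h1 : f^[minimalPeriod f b - t + s] b = b := by
    rw [iterate_add_apply, h, ← iterate_add_apply, Nat.sub_add_cancel ht, iterate_minimalPeriod]
  exact not_isPeriodicPt_of_pos_of_lt_minimalPeriod (by omega) (by omega) h1

/-- Data of a redirection of the edge at a point `b` on a cycle to a point `c` that enters this
cycle after `j` steps, at the point with distance `x` from `b`. -/
structure CycleFlip (f : Q → Q) (b c : Q) (j x : ℕ) : Prop where
  mem : b ∈ periodicPts f
  one_le : 1 ≤ x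
  le_period : x ≤ minimalPeriod f b
  meet : f^[j] c = f^[x] b
  first : ∀ t < j, f^[t] c ∉ periodicPts f

variable {b c : Q}

theorem CycleFlip.iterate_tail {j x : ℕ} (h : CycleFlip f b c j x) {i : ℕ} (hi : j ≤ i) : f^[i] c = f^[i - j + x] b := by
  conv_lhs => rw [← Nat.sub_add_cancel hi, iterate_add_apply, h.meet, ← iterate_add_apply]

theorem CycleFlip.iterate_ne {j x : ℕ} (h : CycleFlip f b c j x) {i : ℕ} (hi : i < j + (minimalPeriod f b - x)) : f^[i] c ≠ b := by
  have h1 := h.le_period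
  have h2 := h.one_le
  rcases Nat.lt_or_ge i j with hij | hij
  · intro hb
    exact h.first i hij (hb ▸ h.mem)
  · rw [h.iterate_tail hij]
    exact fun hb => not_isPeriodicPt_of_pos_of_lt_minimalPeriod (by omega) (by omega) hb

/-- If `c` leads to the point `b` on a cycle, redirecting the edge at `b` to `c` is a cycle
flip. -/
theorem exists_cycleFlip [Finite Q] (hb : b ∈ periodicPts f) {s : ℕ} (hs : f^[s] c = b) :
    ∃ j x, f^[j] c ∈ periodicPts f ∧ CycleFlip f b c j x := by
  obtain ⟨j, hj, hmin⟩ := exists_first_periodic f c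
  have hjs : j ≤ s := by
    by_contra hlt
    exact hmin s (by omega) (hs ▸ hb)
  obtain ⟨m, hm⟩ := exists_iterate_iterate_eq hj (s - j)
  rw [← iterate_add_apply f (s - j), Nat.sub_add_cancel hjs, hs] at hm
  have hpos := minimalPeriod_pos_of_mem_periodicPts hb
  have hmod := iterate_mod_minimalPeriod_eq (f := f) (x := b) (n := m)
  have hlt := Nat.mod_lt m hpos
  rcases Nat.eq_zero_or_pos (m % minimalPeriod f b) with h0 | h0
  · refine ⟨j, minimalPeriod f b, hj, hb, hpos, le_rfl, ?_, hmin⟩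
    rw [h0, hm, iterate_zero_apply] at hmod
    rw [iterate_minimalPeriod, hmod]
  · exact ⟨j, m % minimalPeriod f b, hj, hb, h0, hlt.le, (hmod.trans hm).symm, hmin⟩

variable [DecidableEq Q]

/-- Redirecting the edge at `b` to a point `c` that does not lead to `b`. -/
theorem hasUniqueDeepRoot_update_of_avoid [Finite Q] {L i : ℕ} {v : Q}
    (hc : ∀ i, f^[i] c ≠ b) (hL : ∀ v, f^[L] v ∈ periodicPts f)
    (hv : f^[i] v = b) (hfirst : ∀ t < i, f^[t] v ≠ b)
    (hdeep : L ≤ i ∨ ∃ j, f^[j] c ∉ periodicPts f ∧ L ≤ i + 1 + j) :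
    HasUniqueDeepRoot (update f b c) := by
  set g := update f b c with hg
  have hgc : ∀ n, g^[n] c = f^[n] c := fun n => iterate_update_of_avoid fun i _ => hc i
  have hcper : ∀ n, f^[n] c ∈ periodicPts g ↔ f^[n] c ∈ periodicPts f := fun n =>
    mem_periodicPts_update_iff fun i => by rw [← iterate_add_apply]; exact hc _
  have hgb : ∀ n, g^[n + 1] b = f^[n] c := fun n => by
    rw [iterate_succ_apply, hg, update_self, ← hg, hgc]
  have hbper : b ∉ periodicPts g := by
    intro hb
    obtain ⟨m, hm⟩ := exists_iterate_iterate_eq hb 1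
    rw [hgb 0, iterate_zero_apply, hgc] at hm
    exact hc m hm
  have hpass : ∀ (w : Q) (i : ℕ), f^[i] w = b → (∀ t < i, f^[t] w ≠ b) →
      ∀ n, g^[n + i] w = g^[n] b := by
    intro w i hw hf n
    rw [iterate_add_apply, hg, iterate_update_of_avoid hf, hw]
  obtain ⟨j, hj, hjmin⟩ := exists_first_periodic f c
  -- The new orbit of `b` is `b` followed by the old orbit of `c`, so it enters the cycles after `j
  -- + 1` steps.
  have hbj : g^[j] b ∉ periodicPts g := by
    rcases j with _ | j
    · exact hbper
    · rw [hgb, hcper]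
      exact hjmin j (by omega)
  have hbL : L ≤ i + j := by
    rcases hdeep with h | ⟨j', hj', h⟩
    · omega
    · have : j' < j := by
        by_contra hlt
        exact hj' (iterate_mem_periodicPts_of_le hj (by omega))
      omega
  refine ⟨L, f^[j] c, (hcper j).2 hj, ⟨v, fun hmem => hbj ?_⟩, fun w hw => ?_⟩
  · rw [← hpass v i hv hfirst]
    exact iterate_mem_periodicPts_of_le hmem (by omega)
  -- A vertex whose orbit avoids `b` is unaffected and on a cycle after `L` steps; all deeper
  -- vertices pass through `b` and share its root.
  · have hhit : ∃ i, f^[i] w = b := by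
      by_contra hno
      push Not at hno
      apply hw
      rw [hg, iterate_update_of_avoid fun i _ => hno i]
      exact (mem_periodicPts_update_iff fun i => by
        rw [← iterate_add_apply]; exact hno _).2 (hL w)
    obtain ⟨i', hi', hi'min⟩ := exists_first_hit hhit
    refine ⟨j + i', ?_, ?_⟩
    · rw [hpass w i' hi' hi'min]
      exact hbj
    · rw [show j + i' + 1 = (j + 1) + i' by omega, hpass w i' hi' hi'min, hgb]

/-- Redirecting the edge at a point `b` off the cycles to a point that leads to `b` creates a new
cycle and destroys none. -/
theorem periodicPts_ssubset_update (hb : b ∉ periodicPts f) {j : ℕ} (hj : f^[j] c = b) :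
    periodicPts f ⊂ periodicPts (update f b c) := by
  refine (Set.ssubset_iff_of_subset fun x hx => ?_).2 ⟨b, ?_, hb⟩
  · refine (mem_periodicPts_update_iff fun i hi => hb ?_).2 hx
    rw [← hi]
    exact iterate_mem_periodicPts hx i
  · obtain ⟨i, hi, hmin⟩ := exists_first_hit ⟨j, hj⟩
    refine ⟨i + 1, by omega, ?_⟩
    rw [IsPeriodicPt, IsFixedPt, iterate_succ_apply, update_self, iterate_update_of_avoid hmin, hi]

namespace CycleFlip

variable {j x : ℕ} (h : CycleFlip f b c j x)
include h

/-- The bound is the time at which the orbit of `c` first arrives at `b`; until then the redirected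
edge is not used. -/
theorem update_iterate {i : ℕ} (hi : i ≤ j + (minimalPeriod f b - x)) :
    (update f b c)^[i] c = f^[i] c :=
  iterate_update_of_avoid fun _ ht => h.iterate_ne (by omega)

theorem isPeriodicPt_target :
    IsPeriodicPt (update f b c) (j + (minimalPeriod f b - x) + 1) c := by
  rw [IsPeriodicPt, IsFixedPt, iterate_succ_apply', h.update_iterate le_rfl,
    h.iterate_tail (by omega), show j + (minimalPeriod f b - x) - j + x = minimalPeriod f b by
      have := h.le_period; omega, iterate_minimalPeriod, update_self]

theorem iterate_target_mem {i : ℕ} (hi : i ≤ j + (minimalPeriod f b - x)) :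
    f^[i] c ∈ periodicPts (update f b c) := by
  rw [← h.update_iterate hi]
  exact iterate_mem_periodicPts (mk_mem_periodicPts (by omega) h.isPeriodicPt_target) i

/-- Only the cycle through `b` is affected, and its arc from `f^[x] b` to `b` survives as part of
the new cycle through `c`. -/
theorem mem_of_mem {z : Q} (hz : z ∈ periodicPts f)
    (hseg : ∀ t, 1 ≤ t → t < x → z ≠ f^[t] b) : z ∈ periodicPts (update f b c) := by
  have hx := h.le_period
  by_cases hhit : ∃ i, f^[i] z = b
  · obtain ⟨i, rfl⟩ := hhit
    obtain ⟨m, hm⟩ := exists_iterate_iterate_eq hz i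
    have hpos := minimalPeriod_pos_of_mem_periodicPts h.mem
    have hmod := iterate_mod_minimalPeriod_eq (f := f) (x := f^[i] z) (n := m)
    set n := minimalPeriod f (f^[i] z) with hn
    have hlt : m % n < n := Nat.mod_lt _ hpos
    obtain ⟨t, ht1, htn, ht⟩ : ∃ t, 1 ≤ t ∧ t ≤ n ∧ z = f^[t] (f^[i] z) := by
      rcases Nat.eq_zero_or_pos (m % n) with h0 | h0
      · refine ⟨n, hpos, le_rfl, ?_⟩
        rw [h0, hm, iterate_zero_apply] at hmod
        rw [hn, iterate_minimalPeriod, hmod]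
      · exact ⟨m % n, h0, hlt.le, (hmod.trans hm).symm⟩
    have hxt : x ≤ t := by
      by_contra hlt'
      exact hseg t ht1 (by omega) ht
    have : z = f^[j + (t - x)] c := by
      rw [h.iterate_tail (by omega), show j + (t - x) - j + x = t by omega]
      exact ht
    have hper := h.iterate_target_mem (i := j + (t - x)) (by rw [← hn]; omega)
    rwa [← this] at hper
  · push Not at hhit
    exact (mem_periodicPts_update_iff hhit).2 hz

/-- The abandoned arc runs into the new cycle at `f^[x] b`, so a periodic point on it would lie on
that cycle. But the new cycle consists of the tail of `c`, off the old cycles, and of the other arc.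
-/
theorem segment_notMem {t : ℕ} (ht : 1 ≤ t) (htx : t < x) :
    f^[t] b ∉ periodicPts (update f b c) := by
  have hx := h.le_period
  intro hmem
  have h1 : (update f b c)^[x - t] (f^[t] b) = (update f b c)^[j] c := by
    rw [h.update_iterate (by omega), h.meet, iterate_update_of_avoid, ← iterate_add_apply,
      Nat.sub_add_cancel htx.le]
    intro i hi hb
    rw [← iterate_add_apply] at hb
    exact not_isPeriodicPt_of_pos_of_lt_minimalPeriod (by omega) (by omega) hb
  obtain ⟨M, hM⟩ := exists_iterate_iterate_eq hmem (x - t)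
  rw [h1, ← iterate_add_apply, ← h.isPeriodicPt_target.iterate_mod_apply] at hM
  have hlt := Nat.mod_lt (M + j) (Nat.succ_pos (j + (minimalPeriod f b - x)))
  set s := (M + j) % (j + (minimalPeriod f b - x) + 1) with hs
  rw [h.update_iterate (by omega)] at hM
  rcases Nat.lt_or_ge s j with hsj | hsj
  · exact h.first s hsj (hM ▸ iterate_mem_periodicPts h.mem t)
  · rw [h.iterate_tail hsj] at hM
    exact iterate_ne_iterate_of_lt ht (t := s - j + x) (by omega) (by omega) hM.symm

/-- The flip loses at most the `x - 1` points of the abandoned arc and gains the `j` points of the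
tail of `c`. -/
theorem length_le [Finite Q]
    (hmax : (periodicPts (update f b c)).ncard ≤ (periodicPts f).ncard) : j + 1 ≤ x := by
  classical
  have hx1 := h.one_le
  set seg : Set Q := (fun t => f^[t] b) '' Set.Ico 1 x
  set new : Set Q := (fun t => f^[t] c) '' Set.Iio j
  have hseg : seg.ncard ≤ x - 1 := by
    refine (Set.ncard_image_le (Set.finite_Ico 1 x)).trans ?_
    rw [Set.ncard_eq_toFinset_card', Set.toFinset_Ico, Nat.card_Ico]
  have hnew : new.ncard = j := by
    rw [Set.InjOn.ncard_image, Set.ncard_eq_toFinset_card', Set.toFinset_Iio, Nat.card_Iio]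
    have hlt : ∀ s t, s < t → t < j → f^[s] c ≠ f^[t] c := by
      intro s t hst htj heq
      refine h.first s (by omega) ⟨t - s, by omega, ?_⟩
      rw [IsPeriodicPt, IsFixedPt, ← iterate_add_apply, Nat.sub_add_cancel hst.le, heq]
    intro s hs t ht heq
    rcases Nat.lt_trichotomy s t with hst | hst | hst
    · exact absurd heq (hlt s t hst ht)
    · exact hst
    · exact absurd heq.symm (hlt t s hst hs)
  have hsub : (periodicPts f \ seg) ∪ new ⊆ periodicPts (update f b c) := by
    rintro z (⟨hz, hzs⟩ | ⟨t, ht, rfl⟩)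
    · exact h.mem_of_mem hz fun t h1 h2 he => hzs ⟨t, ⟨h1, h2⟩, he.symm⟩
    · exact h.iterate_target_mem (le_trans (le_of_lt ht) (by omega))
  have hdisj : Disjoint (periodicPts f \ seg) new := by
    rw [Set.disjoint_left]
    rintro z ⟨hz, -⟩ ⟨t, ht, rfl⟩
    exact h.first t ht hz
  have h1 := Set.ncard_le_ncard hsub (Set.toFinite _)
  rw [Set.ncard_union_eq hdisj (Set.toFinite _) (Set.toFinite _), hnew] at h1
  have h2 := Set.le_ncard_sdiff seg (periodicPts f) (Set.toFinite _)
  omega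

/-- The abandoned arc becomes a tail attached to the new cycle at `f^[x] b`. Vertices deeper than
`L` must run through it, and `hdeep` makes `v`, which runs through all of it, such a vertex: its new
depth is `i + x - 1`. -/
theorem hasUniqueDeepRoot [Finite Q] {L i : ℕ} {v : Q}
    (hL : ∀ v, f^[L] v ∈ periodicPts f) (hv : f^[i] v = f b)
    (hfirst : ∀ t < i, f^[t] v ∉ periodicPts f) (hx : 2 ≤ x) (hdeep : L + 2 ≤ i + x) :
    HasUniqueDeepRoot (update f b c) := by
  have hxp := h.le_period
  have hstart : ∀ (w : Q) (i : ℕ), (∀ t < i, f^[t] w ∉ periodicPts f) →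
      (update f b c)^[i] w = f^[i] w := fun w i hw =>
    iterate_update_of_avoid fun t ht hb => hw t ht (hb ▸ h.mem)
  have hwalk : ∀ t s, 1 ≤ t → t + s ≤ x → (update f b c)^[s] (f^[t] b) = f^[t + s] b := by
    intro t s ht hts
    rw [iterate_update_of_avoid, ← iterate_add_apply, Nat.add_comm]
    intro i hi hb
    rw [← iterate_add_apply] at hb
    exact not_isPeriodicPt_of_pos_of_lt_minimalPeriod (by omega) (by omega) hb
  have hlast := h.segment_notMem (t := x - 1) (by omega) (by omega)
  refine ⟨L, f^[x] b, ?_, ⟨v, fun hmem => ?_⟩, fun w hw => ?_⟩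
  · rw [← h.meet]
    exact h.iterate_target_mem (by omega)
  · have h1 : (update f b c)^[x - 2 + i] v = f^[x - 1] b := by
      rw [iterate_add_apply, hstart v i hfirst, hv, show f b = f^[1] b from rfl,
        hwalk 1 _ le_rfl (by omega), show 1 + (x - 2) = x - 1 by omega]
    exact hlast (h1 ▸ iterate_mem_periodicPts_of_le hmem (by omega))
  · obtain ⟨i', hi', hmin⟩ := exists_first_periodic f w
    have hi'L : i' ≤ L := by
      by_contra hlt
      exact hmin L (by omega) (hL w)
    have hz : f^[i'] w ∉ periodicPts (update f b c) := fun hmem =>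
      hw (iterate_mem_periodicPts_of_le (by rwa [hstart w i' hmin]) hi'L)
    obtain ⟨t, ht1, htx, ht⟩ : ∃ t, 1 ≤ t ∧ t < x ∧ f^[i'] w = f^[t] b := by
      by_contra hno
      push Not at hno
      exact hz (h.mem_of_mem hi' hno)
    refine ⟨x - 1 - t + i', ?_, ?_⟩
    · rw [iterate_add_apply, hstart w i' hmin, ht, hwalk t _ ht1 (by omega),
        show t + (x - 1 - t) = x - 1 by omega]
      exact hlast
    · rw [show x - 1 - t + i' + 1 = x - t + i' by omega, iterate_add_apply, hstart w i' hmin, ht,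
        hwalk t _ ht1 (by omega), Nat.add_sub_cancel' htx.le]

end CycleFlip

end FunctionalGraph

end RoadColoring

namespace RoadColoring

/-! ### Choosing one edge at every vertex -/

section ChoiceFunctions

open Function

variable {Q : Type*} {R : Q → Q → Prop} {f : Q → Q}

theorem forall_update_of_forall [DecidableEq Q] (hf : ∀ q, R q (f q)) {b c : Q} (hbc : R b c)
    (q : Q) : R q (update f b c q) := by
  rcases eq_or_ne q b with rfl | hq
  · rwa [update_self]
  · rw [update_of_ne hq]
    exact hf q

variable [Finite Q]

/-- Redirecting an edge to a point `p` at maximal distance `l + 1` from the cycles succeeds,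
except possibly if it starts at distance `l + 2` on the cycle that `p` leads to. -/
theorem exists_hasUniqueDeepRoot_or (hf : ∀ q, R q (f q))
    (hmax : ∀ g : Q → Q, (∀ q, R q (g q)) → (periodicPts g).ncard ≤ (periodicPts f).ncard)
    {l : ℕ} (hl : ∀ v, f^[l + 1] v ∈ periodicPts f) {p b : Q} (hp : f^[l] p ∉ periodicPts f)
    (hbp : R b p) :
    (∃ g : Q → Q, (∀ q, R q (g q)) ∧ HasUniqueDeepRoot g) ∨
      (b ∈ periodicPts f ∧ f^[l + 2] b = f^[l + 1] p) := by
  classical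
  have hg := forall_update_of_forall hf hbp
  by_cases hflow : ∃ s, f^[s] p = b
  · obtain ⟨s, hs⟩ := hflow
    by_cases hb : b ∈ periodicPts f
    · obtain ⟨j, x, hj, hflip⟩ := exists_cycleFlip hb hs
      have hjl : j = l + 1 := by
        apply le_antisymm
        · by_contra hlt
          exact hflip.first (l + 1) (by omega) (hl p)
        · by_contra hlt
          exact hp (iterate_mem_periodicPts_of_le hj (by omega))
      have hle := hflip.length_le (hmax _ hg)
      -- Maximality gives `x ≥ l + 2`. If the inequality is strict, the abandoned arc starting at `f
      -- b` is longer than any old tail.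
      rcases eq_or_ne x (l + 2) with hx | hx
      · refine Or.inr ⟨hb, ?_⟩
        rw [← hx, ← hflip.meet, hjl]
      · exact Or.inl ⟨_, hg, hflip.hasUniqueDeepRoot hl (v := f b) (i := 0) rfl
          (fun t ht => absurd ht (Nat.not_lt_zero t)) (by omega) (by omega)⟩
    · exact absurd (hmax _ hg) (not_le.2
        (Set.ncard_lt_ncard (periodicPts_ssubset_update hb hs) (Set.toFinite _)))
  · push Not at hflow
    exact Or.inl ⟨_, hg, hasUniqueDeepRoot_update_of_avoid hflow hl (v := b) (i := 0) rfl
      (fun t ht => absurd ht (Nat.not_lt_zero t)) (Or.inr ⟨l, hp, by omega⟩)⟩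

/-- A permutation with a vertex where another edge can be chosen. -/
theorem exists_hasUniqueDeepRoot_of_forall_mem (hf : ∀ q, R q (f q))
    (hper : ∀ v, v ∈ periodicPts f) {b c : Q} (hbc : R b c) (hne : f b ≠ c) :
    ∃ g : Q → Q, (∀ q, R q (g q)) ∧ HasUniqueDeepRoot g := by
  classical
  refine ⟨update f b c, forall_update_of_forall hf hbc, ?_⟩
  by_cases hflow : ∃ s, f^[s] c = b
  · obtain ⟨s, hs⟩ := hflow
    obtain ⟨j, x, hj, hflip⟩ := exists_cycleFlip (hper b) hs
    have hj0 : j = 0 := by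
      by_contra h0
      exact hflip.first 0 (by omega) (hper _)
    have hx : x ≠ 1 := by
      rintro rfl
      exact hne (by simpa [hj0] using hflip.meet.symm)
    have := hflip.one_le
    exact hflip.hasUniqueDeepRoot (L := 0) hper (v := f b) (i := 0) rfl
      (fun t ht => absurd ht (Nat.not_lt_zero t)) (by omega) (by omega)
  · push Not at hflow
    exact hasUniqueDeepRoot_update_of_avoid (L := 0) hflow hper (v := b) (i := 0) rfl
      (fun t ht => absurd ht (Nat.not_lt_zero t)) (Or.inl le_rfl)

/-- Redirecting the edge on a cycle that enters the root of a point at maximal distance. -/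
theorem exists_hasUniqueDeepRoot_of_cycle_edge (hf : ∀ q, R q (f q))
    (hmax : ∀ g : Q → Q, (∀ q, R q (g q)) → (periodicPts g).ncard ≤ (periodicPts f).ncard)
    {l : ℕ} (hl : ∀ v, f^[l + 1] v ∈ periodicPts f) {p c : Q} (hp : f^[l] p ∉ periodicPts f)
    (hc : c ∈ periodicPts f) (hcr : f c = f^[l + 1] p) {c' : Q} (hcc' : R c c')
    (hne : c' ≠ f c) :
    ∃ g : Q → Q, (∀ q, R q (g q)) ∧ HasUniqueDeepRoot g := by
  classical
  have hg := forall_update_of_forall hf hcc'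
  have hp' : ∀ t < l + 1, f^[t] p ∉ periodicPts f := fun t ht hmem =>
    hp (iterate_mem_periodicPts_of_le hmem (by omega))
  refine ⟨update f c c', hg, ?_⟩
  by_cases hflow : ∃ s, f^[s] c' = c
  · obtain ⟨s, hs⟩ := hflow
    obtain ⟨j, x, hj, hflip⟩ := exists_cycleFlip hc hs
    have hle := hflip.length_le (hmax _ hg)
    -- For `x = 1` maximality leaves `j = 0`, and the edge would not have changed its target. For `x
    -- ≥ 2` the old root leaves the cycle, so `p` gets deeper than `l + 1`.
    have hx : x ≠ 1 := by
      rintro rfl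
      obtain rfl : j = 0 := by omega
      exact hne hflip.meet
    have := hflip.one_le
    exact hflip.hasUniqueDeepRoot hl (v := p) (i := l + 1) hcr.symm hp' (by omega) (by omega)
  · push Not at hflow
    obtain ⟨m, hm⟩ := exists_iterate_iterate_eq hc 1
    obtain ⟨i, hi, hmin⟩ := exists_first_hit (f := f) (x := p) (b := c) ⟨m + (l + 1), by
      rw [iterate_add_apply, ← hcr]; exact hm⟩
    -- `p` cannot meet `c`, which is on a cycle, before step `l + 1`.
    refine hasUniqueDeepRoot_update_of_avoid hflow hl hi hmin (Or.inl ?_)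
    by_contra hlt
    exact hp' i (by omega) (hi ▸ hc)

/-- Redirecting the edge off the cycles that enters the root of a point at maximal distance. -/
theorem exists_hasUniqueDeepRoot_of_tree_edge (hf : ∀ q, R q (f q)) (hin : ∀ q, ∃ p, R p q)
    (hmax : ∀ g : Q → Q, (∀ q, R q (g q)) → (periodicPts g).ncard ≤ (periodicPts f).ncard)
    {l : ℕ} (hl : ∀ v, f^[l + 1] v ∈ periodicPts f) {p : Q} (hp : f^[l] p ∉ periodicPts f)
    {e' : Q} (hee' : R (f^[l] p) e') (hne : e' ≠ f^[l + 1] p) :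
    ∃ g : Q → Q, (∀ q, R q (g q)) ∧ HasUniqueDeepRoot g := by
  classical
  set e := f^[l] p with he
  have hg := forall_update_of_forall hf hee'
  have hflow : ∀ s, f^[s] e' ≠ e := fun s hs => absurd (hmax _ hg) (not_le.2
    (Set.ncard_lt_ncard (periodicPts_ssubset_update hp hs) (Set.toFinite _)))
  have hmin : ∀ t < l, f^[t] p ≠ e := by
    intro t ht hte
    refine hp ⟨l - t, by omega, ?_⟩
    rw [IsPeriodicPt, IsFixedPt]
    nth_rewrite 1 [← hte]
    rw [← iterate_add_apply, Nat.sub_add_cancel ht.le]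
  -- If `e'` is on a cycle, the redirection keeps the old cycles and the depth bound `l + 1`, but
  -- moves the root of `p` to `e'`. A predecessor `b` of `p` is the exception in
  -- `exists_hasUniqueDeepRoot_or` for at most one of the two roots, as `l + 2` steps along the
  -- cycle of `b` end at one point.
  by_cases he' : e' ∈ periodicPts f
  · have hcyc : ∀ x ∈ periodicPts f, ∀ i, f^[i] x ≠ e := fun x hx i hi =>
      hp (hi ▸ iterate_mem_periodicPts hx i)
    set g := update f e e' with hgdef
    have hmono : ∀ x ∈ periodicPts f, x ∈ periodicPts g := fun x hx =>
      (mem_periodicPts_update_iff (hcyc x hx)).2 hx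
    have hgp : g^[l] p = e := iterate_update_of_avoid hmin
    have hgp' : g^[l + 1] p = e' := by
      rw [iterate_succ_apply', hgp, hgdef, update_self]
    have heg : e ∉ periodicPts g := by
      intro hmem
      obtain ⟨m, hm⟩ := exists_iterate_iterate_eq hmem 1
      rw [iterate_one, hgdef, update_self, iterate_update_of_avoid fun i _ => hflow i] at hm
      exact hflow m hm
    have hgmax : ∀ g' : Q → Q, (∀ q, R q (g' q)) →
        (periodicPts g').ncard ≤ (periodicPts g).ncard := fun g' hg' =>
      (hmax g' hg').trans (Set.ncard_le_ncard hmono (Set.toFinite _))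
    have hgl : ∀ v, g^[l + 1] v ∈ periodicPts g := by
      intro v
      by_cases hhit : ∃ i, f^[i] v = e
      · obtain ⟨i, hi, himin⟩ := exists_first_hit hhit
        have hil : i ≤ l := by
          by_contra hlt
          exact hp (hi ▸ iterate_mem_periodicPts_of_le (hl v) (by omega : l + 1 ≤ i))
        have h1 : g^[i + 1] v = e' := by
          rw [iterate_succ_apply', hgdef, iterate_update_of_avoid himin, hi, update_self]
        exact iterate_mem_periodicPts_of_le (h1 ▸ hmono e' he') (by omega)
      · push Not at hhit
        rw [hgdef, iterate_update_of_avoid fun i _ => hhit i]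
        exact hmono _ (hl v)
    obtain ⟨b, hb⟩ := hin p
    rcases exists_hasUniqueDeepRoot_or hf hmax hl hp hb with h | ⟨hbper, h1⟩
    · exact h
    rcases exists_hasUniqueDeepRoot_or hg hgmax hgl (by rwa [hgp]) hb with h | ⟨-, h2⟩
    · exact h
    rw [hgp', iterate_update_of_avoid fun i _ => hcyc b hbper i, h1] at h2
    exact absurd h2.symm hne
  · exact ⟨_, hg, hasUniqueDeepRoot_update_of_avoid hflow hl he.symm hmin
      (Or.inr ⟨0, he', by omega⟩)⟩

/-- In a finite graph in which every vertex has an incoming and an outgoing edge, some vertex has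
two successors, and no vertex is the only successor of two vertices, one can choose an edge at
every vertex such that the deepest points all belong to one tree. -/
theorem exists_choice_hasUniqueDeepRoot (hout : ∀ q, ∃ q', R q q') (hin : ∀ q, ∃ p, R p q)
    (hbranch : ∃ q c c', R q c ∧ R q c' ∧ c ≠ c')
    (hbunch : ∀ e c r, e ≠ c → R e r → R c r → ∃ r', r' ≠ r ∧ (R e r' ∨ R c r')) :
    ∃ f : Q → Q, (∀ q, R q (f q)) ∧ HasUniqueDeepRoot f := by
  classical
  choose f₀ hf₀ using hout
  obtain ⟨f, hf, hmax⟩ := Set.exists_max_image {f : Q → Q | ∀ q, R q (f q)}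
    (fun f => (periodicPts f).ncard) (Set.toFinite _) ⟨f₀, hf₀⟩
  obtain ⟨i, hi⟩ := exists_iterate_mem_periodicPts f
  have hex : ∃ t, ∀ v, f^[t] v ∈ periodicPts f := ⟨i, hi⟩
  obtain ⟨L, hL, hLmin⟩ : ∃ L, (∀ v, f^[L] v ∈ periodicPts f) ∧
      ∀ t < L, ∃ v, f^[t] v ∉ periodicPts f :=
    ⟨Nat.find hex, Nat.find_spec hex, fun t ht => by simpa using Nat.find_min hex ht⟩
  rcases L with _ | l
  · obtain ⟨q, c, c', hc, hc', hne⟩ := hbranch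
    by_cases hfc : f q = c
    · exact exists_hasUniqueDeepRoot_of_forall_mem hf hL hc' (hfc ▸ hne)
    · exact exists_hasUniqueDeepRoot_of_forall_mem hf hL hc hfc
  · obtain ⟨p, hp⟩ := hLmin l (by omega)
    have hr := hL p
    obtain ⟨N, hN, hNper⟩ := exists_common_period f
    set r := f^[l + 1] p with hrdef
    -- `c` precedes the root on its cycle, and `f^[l] p` precedes it in the tree. By `hbunch` one of
    -- the two has another successor to be redirected to.
    set c := f^[N - 1] r with hcdef
    have hc : c ∈ periodicPts f := iterate_mem_periodicPts hr _
    have hcr : f c = r := by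
      rw [hcdef, ← iterate_succ_apply' f, show (N - 1).succ = N by omega, hNper r hr]
    have her : f (f^[l] p) = r := (iterate_succ_apply' f l p).symm
    obtain ⟨r', hr', h | h⟩ := hbunch (f^[l] p) c r (fun h => hp (h ▸ hc)) (her ▸ hf _)
      (hcr ▸ hf _)
    · exact exists_hasUniqueDeepRoot_of_tree_edge hf hin hmax hL hp h hr'
    · exact exists_hasUniqueDeepRoot_of_cycle_edge hf hmax hL hp hc hcr h (hcr ▸ hr')

end ChoiceFunctions

end RoadColoring

namespace RoadColoring

/-! ### Stable pairs and the road coloring of automata -/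

section Automata

open Function

variable {Q A : Type*}

/-- The set of states in which a run labelled by the word `w` may end. -/
def wordImage (δ : Q → A → Q) (w : List A) : Set Q :=
  Set.range fun p => w.foldl δ p

/-- The states `p` and `q` can be merged after every word. -/
def StablePair (δ : Q → A → Q) (p q : Q) : Prop :=
  ∀ u : List A, ∃ v : List A, (u ++ v).foldl δ p = (u ++ v).foldl δ q

/-- The recoloring of an automaton by permutations of the letters at every state. -/
def recolor (δ : Q → A → Q) (π : Q → Equiv.Perm A) : Q → A → Q :=
  fun q a => δ q (π q a)

variable {δ : Q → A → Q}

theorem wordImage_append (u w : List A) :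
    wordImage δ (u ++ w) = (fun p => w.foldl δ p) '' wordImage δ u := by
  simp only [wordImage, List.foldl_append, ← Set.range_comp, comp_def]

theorem wordImage_append_subset (u w : List A) : wordImage δ (u ++ w) ⊆ wordImage δ w := by
  rintro _ ⟨p, rfl⟩
  exact ⟨u.foldl δ p, by simp only [List.foldl_append]⟩

theorem foldl_replicate (a : A) (n : ℕ) (p : Q) :
    (List.replicate n a).foldl δ p = (fun q => δ q a)^[n] p := by
  induction n generalizing p with
  | zero => rfl
  | succ n ih => rw [List.replicate_succ, List.foldl_cons, ih, iterate_succ_apply]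

theorem exists_foldl_recolor (π : Q → Equiv.Perm A) (p : Q) (w : List A) :
    ∃ w' : List A, w'.length = w.length ∧ w'.foldl (recolor δ π) p = w.foldl δ p := by
  induction w generalizing p with
  | nil => exact ⟨[], rfl, rfl⟩
  | cons a w ih =>
    obtain ⟨w', hlen, hw'⟩ := ih (δ p a)
    exact ⟨(π p).symm a :: w', by simp [hlen], by simpa [recolor] using hw'⟩

/-- The stable pairs form a congruence. -/
def stableSetoid (δ : Q → A → Q) : Setoid Q where
  r := StablePair δ
  iseqv :=
    { refl := fun p u => ⟨[], rfl⟩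
      symm := fun h u => (h u).imp fun _ hv => hv.symm
      trans := by
        intro p q r hpq hqr u
        obtain ⟨v, hv⟩ := hpq u
        obtain ⟨v', hv'⟩ := hqr (u ++ v)
        refine ⟨v ++ v', ?_⟩
        rw [← List.append_assoc, ← hv', List.foldl_append, hv, ← List.foldl_append] }

theorem StablePair.step {p q : Q} (h : StablePair δ p q) (a : A) :
    StablePair δ (δ p a) (δ q a) := fun u => h (a :: u)

section MinimalImages

/-- A word of minimal rank. -/
def IsMinimalWord (δ : Q → A → Q) (w : List A) : Prop :=
  ∀ w' : List A, (wordImage δ w).ncard ≤ (wordImage δ w').ncard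

theorem exists_isMinimalWord (δ : Q → A → Q) : ∃ w, IsMinimalWord δ w := by
  obtain ⟨w, hw⟩ := (measure fun w : List A => (wordImage δ w).ncard).wf.has_min Set.univ
    ⟨[], trivial⟩
  exact ⟨w, fun w' => not_lt.1 (hw.2 w' trivial)⟩

variable [Finite Q]

theorem ncard_wordImage_append_le (u w : List A) :
    (wordImage δ (u ++ w)).ncard ≤ (wordImage δ u).ncard := by
  rw [wordImage_append]
  exact Set.ncard_image_le (Set.toFinite _)

theorem IsMinimalWord.append {w : List A} (h : IsMinimalWord δ w) (u : List A) :
    IsMinimalWord δ (w ++ u) := fun w' => (ncard_wordImage_append_le w u).trans (h w')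

/-- A word that merged two elements of a minimal image would lower the rank. -/
theorem IsMinimalWord.injOn {w : List A} (h : IsMinimalWord δ w) (u : List A) :
    Set.InjOn (fun p => u.foldl δ p) (wordImage δ w) := by
  apply Set.injOn_of_ncard_image_eq _ (Set.toFinite _)
  rw [← wordImage_append]
  exact le_antisymm (ncard_wordImage_append_le w u) (h _)

/-- If two minimal images differ in one element, the two elements form a stable pair. -/
theorem stablePair_of_minimal {w₁ w₂ : List A} (h₁ : IsMinimalWord δ w₁)
    (h₂ : IsMinimalWord δ w₂) {p q : Q} (hp : p ∈ wordImage δ w₁) (hq : q ∈ wordImage δ w₂)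
    (hq₁ : q ∉ wordImage δ w₁) (hsub : ∀ x ∈ wordImage δ w₁, x ≠ p → x ∈ wordImage δ w₂) :
    StablePair δ p q := by
  by_contra hns
  simp only [StablePair, not_forall, not_exists] at hns
  obtain ⟨u, hu⟩ := hns
  -- If nothing after `u` merges `p` and `q`, then `u ++ w₁` is injective on the image of `w₁`
  -- enlarged by `q`, yet sends it into the image of `w₁`, which is too small.
  have hqx : ∀ x ∈ wordImage δ w₁, (u ++ w₁).foldl δ x ≠ (u ++ w₁).foldl δ q := by
    intro x hx heq
    rcases eq_or_ne x p with rfl | hxp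
    · exact hu w₁ heq
    · exact hq₁ (h₂.injOn (u ++ w₁) (hsub x hx hxp) hq heq ▸ hx)
  have hinj : Set.InjOn (fun x => (u ++ w₁).foldl δ x) (insert q (wordImage δ w₁)) := by
    rw [Set.injOn_insert hq₁]
    exact ⟨h₁.injOn _, fun ⟨x, hx, heq⟩ => hqx x hx heq⟩
  have hle : ((fun x => (u ++ w₁).foldl δ x) '' insert q (wordImage δ w₁)).ncard ≤
      (wordImage δ w₁).ncard := by
    apply Set.ncard_le_ncard _ (Set.toFinite _)
    rintro _ ⟨x, -, rfl⟩
    exact wordImage_append_subset u w₁ ⟨x, rfl⟩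
  rw [hinj.ncard_image, Set.ncard_insert_of_notMem hq₁ (Set.toFinite _)] at hle
  omega

/-- By connectivity some minimal image contains a deepest vertex `v`. After `n` letters `a` exactly
one element is off the cycles, since two would be merged by the next `a`. A common period of further
letters `a` fixes the others and puts this one on a cycle, which gives two minimal images differing
in one element. -/
theorem exists_stablePair_of_hasUniqueDeepRoot (hconn : ∀ p q, ∃ w : List A, w.foldl δ p = q)
    {a : A} (ha : HasUniqueDeepRoot fun q => δ q a) : ∃ p q, p ≠ q ∧ StablePair δ p q := by
  set f : Q → Q := fun q => δ q a with hf
  obtain ⟨n, ⟨v, hv⟩, hn, hroot⟩ := ha.exists_max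
  obtain ⟨w₀, hw₀⟩ := exists_isMinimalWord δ
  obtain ⟨w₁, hw₁⟩ := hconn (w₀.foldl δ v) v
  have hmin := hw₀.append w₁
  have hvmem : v ∈ wordImage δ (w₀ ++ w₁) := ⟨v, by simp only [List.foldl_append]; exact hw₁⟩
  obtain ⟨N, hN, hNper⟩ := exists_common_period f
  set w₂ := (w₀ ++ w₁) ++ List.replicate n a with hw₂
  have hmin₂ : IsMinimalWord δ w₂ := hmin.append _
  have hmin₃ : IsMinimalWord δ (w₂ ++ List.replicate N a) := hmin₂.append _
  set p := f^[n] v with hp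
  have hpmem : p ∈ wordImage δ w₂ := by
    rw [hw₂, wordImage_append]
    exact ⟨v, hvmem, foldl_replicate a n v⟩
  have hother : ∀ x ∈ wordImage δ w₂, x ≠ p → x ∈ periodicPts f := by
    intro x hx hxp
    rw [hw₂, wordImage_append] at hx
    obtain ⟨y, hy, rfl⟩ := hx
    by_contra hnot
    simp only [foldl_replicate] at hnot hxp
    have h1 := hroot y v hnot hv
    have h2 := hmin.injOn (List.replicate (n + 1) a) hy hvmem (by
      simp only [foldl_replicate]; exact h1)
    exact hxp (by rw [h2])
  have hqper : f^[N] p ∈ periodicPts f := by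
    rw [hp, ← iterate_add_apply]
    exact iterate_mem_periodicPts_of_le (hn v) (by omega)
  have hqp : p ≠ f^[N] p := fun h => hv (h ▸ hqper)
  refine ⟨p, f^[N] p, hqp, stablePair_of_minimal hmin₂ hmin₃ hpmem ?_ ?_ ?_⟩
  · rw [wordImage_append]
    exact ⟨p, hpmem, foldl_replicate a N p⟩
  · intro hmem
    refine hqp (hmin₂.injOn (List.replicate N a) hpmem hmem ?_)
    simp only [foldl_replicate]
    exact (hNper _ hqper).symm
  · intro x hx hxp
    rw [wordImage_append]
    refine ⟨x, hx, ?_⟩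
    simp only [foldl_replicate]
    exact hNper x (hother x hx hxp)

end MinimalImages

/-- Every function that follows edges is the action of a given letter in some recoloring. -/
theorem exists_recolor_eq (δ : Q → A → Q) (a : A) {f : Q → Q} (hf : ∀ q, ∃ b, δ q b = f q) :
    ∃ π : Q → Equiv.Perm A, (fun q => recolor δ π q a) = f := by
  classical
  choose b hb using hf
  exact ⟨fun q => Equiv.swap a (b q), funext fun q => by simp [recolor, hb]⟩

theorem exists_foldl_eq_recolor (hconn : ∀ p q, ∃ w : List A, w.foldl δ p = q)
    (π : Q → Equiv.Perm A) (p q : Q) : ∃ w : List A, w.foldl (recolor δ π) p = q := by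
  obtain ⟨w, hw⟩ := hconn p q
  obtain ⟨w', -, hw'⟩ := exists_foldl_recolor (δ := δ) π p w
  exact ⟨w', hw'.trans hw⟩

theorem exists_pred [Nonempty A] (hconn : ∀ p q, ∃ w : List A, w.foldl δ p = q) (q : Q) :
    ∃ p a, δ p a = q := by
  obtain ⟨a⟩ := ‹Nonempty A›
  obtain ⟨w, hw⟩ := hconn (δ q a) q
  rcases w.eq_nil_or_concat with rfl | ⟨w, b, rfl⟩
  · exact ⟨q, a, hw⟩
  · exact ⟨w.foldl δ (δ q a), b, by simpa [List.concat_eq_append] using hw⟩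

/-- If some state has two successors, some recoloring has a nontrivial stable pair. -/
theorem exists_recolor_stablePair [Finite Q] [Nonempty A]
    (hconn : ∀ p q, ∃ w : List A, w.foldl δ p = q) (hbranch : ∃ q a b, δ q a ≠ δ q b) :
    ∃ (π : Q → Equiv.Perm A) (p q : Q), p ≠ q ∧ StablePair (recolor δ π) p q := by
  classical
  obtain ⟨a⟩ := ‹Nonempty A›
  by_cases hbunch : ∀ e c r, e ≠ c → (∃ b, δ e b = r) → (∃ b, δ c b = r) →
      ∃ r', r' ≠ r ∧ ((∃ b, δ e b = r') ∨ ∃ b, δ c b = r')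
  · obtain ⟨q, b, b', hb⟩ := hbranch
    obtain ⟨f, hf, hroot⟩ := exists_choice_hasUniqueDeepRoot (R := fun q q' => ∃ b, δ q b = q')
      (fun q => ⟨_, a, rfl⟩) (fun q => exists_pred hconn q)
      ⟨q, _, _, ⟨b, rfl⟩, ⟨b', rfl⟩, hb⟩ hbunch
    obtain ⟨π, hπ⟩ := exists_recolor_eq δ a hf
    exact ⟨π, exists_stablePair_of_hasUniqueDeepRoot (exists_foldl_eq_recolor hconn π)
      (a := a) (hπ ▸ hroot)⟩
  -- Otherwise two distinct states have the same single successor, and every letter merges them.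
  · push Not at hbunch
    obtain ⟨e, c, r, hec, -, -, h⟩ := hbunch
    have he : ∀ b, δ e b = r := fun b => by
      by_contra hne
      exact (h _ hne).1 b rfl
    have hc : ∀ b, δ c b = r := fun b => by
      by_contra hne
      exact (h _ hne).2 b rfl
    refine ⟨fun _ => 1, e, c, hec, fun u => ⟨[a], ?_⟩⟩
    cases u <;> simp [recolor, he, hc]

/-! ### The stable quotient and induction on the number of states -/

/-- The automaton on the classes of stable pairs. -/
def stableQuotient (δ : Q → A → Q) : Quotient (stableSetoid δ) → A → Quotient (stableSetoid δ) :=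
  fun q a => Quotient.map (fun p => δ p a)
    (fun _ _ h => StablePair.step h a) q

theorem foldl_stableQuotient (w : List A) (p : Q) :
    w.foldl (stableQuotient δ) (Quotient.mk _ p) = Quotient.mk (stableSetoid δ) (w.foldl δ p) := by
  induction w generalizing p with
  | nil => rfl
  | cons a w ih => exact ih (δ p a)

/-- The recoloring of an automaton that a recoloring of its stable quotient induces. -/
def liftRecolor (δ : Q → A → Q) (π : Quotient (stableSetoid δ) → Equiv.Perm A) : Q → A → Q :=
  recolor δ fun q => π (Quotient.mk _ q)

theorem foldl_liftRecolor (π : Quotient (stableSetoid δ) → Equiv.Perm A) (w : List A) (p : Q) :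
    Quotient.mk (stableSetoid δ) (w.foldl (liftRecolor δ π) p) =
      w.foldl (recolor (stableQuotient δ) π) (Quotient.mk _ p) := by
  induction w generalizing p with
  | nil => rfl
  | cons a w ih => exact ih (liftRecolor δ π p a)

/-- Some word acts in the lifted recoloring, on all states in the class of `p`, as `w` does in the
original automaton. -/
theorem exists_foldl_liftRecolor (π : Quotient (stableSetoid δ) → Equiv.Perm A) (w : List A)
    (p : Q) : ∃ w' : List A, ∀ q, StablePair δ p q →
      w'.foldl (liftRecolor δ π) q = w.foldl δ q := by
  induction w generalizing p with
  | nil => exact ⟨[], fun _ _ => rfl⟩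
  | cons a w ih =>
    obtain ⟨w', hw'⟩ := ih (δ p a)
    refine ⟨(π (Quotient.mk _ p)).symm a :: w', fun q hpq => ?_⟩
    have hq : Quotient.mk (stableSetoid δ) p = Quotient.mk _ q := Quotient.sound hpq
    simp only [List.foldl_cons, liftRecolor, recolor, ← hq, Equiv.apply_symm_apply]
    exact hw' _ (hpq.step a)

/-- A minimal image of the lifted automaton meets every class at most once: a word of `δ` merging
two stable states can be imitated in the lift, against injectivity on minimal images. So projecting
it to the quotient loses no elements. -/
theorem exists_ncard_wordImage_liftRecolor_le [Finite Q]
    (π : Quotient (stableSetoid δ) → Equiv.Perm A) (w : List A) :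
    ∃ w' : List A, (wordImage (liftRecolor δ π) w').ncard ≤
      (wordImage (recolor (stableQuotient δ) π) w).ncard := by
  obtain ⟨w₀, hw₀⟩ := exists_isMinimalWord (liftRecolor δ π)
  refine ⟨w₀ ++ w, ?_⟩
  have hmin := hw₀.append w
  have hinj : Set.InjOn (Quotient.mk (stableSetoid δ)) (wordImage (liftRecolor δ π) (w₀ ++ w)) := by
    intro x hx y hy hxy
    have hst : StablePair δ x y := Quotient.exact hxy
    obtain ⟨v, hv⟩ := hst []
    obtain ⟨v', hv'⟩ := exists_foldl_liftRecolor π v x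
    refine hmin.injOn v' hx hy ?_
    show v'.foldl _ x = v'.foldl _ y
    rw [hv' x ((stableSetoid δ).refl x), hv' y hst]
    exact hv
  rw [← hinj.ncard_image]
  apply Set.ncard_le_ncard _ (Set.toFinite _)
  rintro _ ⟨x, hx, rfl⟩
  obtain ⟨p, rfl⟩ := wordImage_append_subset _ _ hx
  exact ⟨Quotient.mk _ p, (foldl_liftRecolor π w p).symm⟩

/-- If every state has only one successor, the number of states divides all cycle lengths. -/
theorem card_dvd_of_forall_eq [Finite Q] [Nonempty A]
    (hconn : ∀ p q, ∃ w : List A, w.foldl δ p = q) (h : ∀ q a b, δ q a = δ q b)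
    {q : Q} {w : List A} (hw : w.foldl δ q = q) : Nat.card Q ∣ w.length := by
  obtain ⟨a⟩ := ‹Nonempty A›
  have hδ : ∀ (w : List A) (p : Q), w.foldl δ p = (fun q => δ q a)^[w.length] p := by
    intro w
    induction w with
    | nil => exact fun _ => rfl
    | cons b w ih =>
      intro p
      rw [List.foldl_cons, ih, List.length_cons, iterate_succ_apply, h p b a]
  set f : Q → Q := fun q => δ q a
  have hreach : ∀ p, ∃ n, f^[n] q = p := fun p => by
    obtain ⟨w, hw⟩ := hconn q p
    exact ⟨w.length, hδ w q ▸ hw⟩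
  have hper : q ∈ periodicPts f := by
    obtain ⟨w, hw⟩ := hconn (f q) q
    exact ⟨w.length + 1, by omega, by rw [IsPeriodicPt, IsFixedPt, iterate_succ_apply, ← hδ, hw]⟩
  have hcard : Nat.card Q = minimalPeriod f q := by
    have hbij : Bijective fun i : Fin (minimalPeriod f q) => f^[(i : ℕ)] q := by
      constructor
      · intro i j hij
        exact Fin.ext (iterate_injOn_Iio_minimalPeriod i.2 j.2 hij)
      · intro p
        obtain ⟨n, hn⟩ := hreach p
        refine ⟨⟨n % minimalPeriod f q,
          Nat.mod_lt _ (minimalPeriod_pos_of_mem_periodicPts hper)⟩, ?_⟩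
        exact iterate_mod_minimalPeriod_eq.trans hn
    rw [← Nat.card_congr (Equiv.ofBijective _ hbij), Nat.card_eq_fintype_card, Fintype.card_fin]
  rw [hcard]
  apply IsPeriodicPt.minimalPeriod_dvd
  rw [IsPeriodicPt, IsFixedPt, ← hδ, hw]

/-- The periodic road coloring theorem for automata: if every common divisor of the cycle lengths
is at most `k`, then some recoloring has a word of rank at most `k`. -/
theorem exists_recolor_ncard_wordImage_le {A : Type*} [Nonempty A] {k : ℕ} (n : ℕ) :
    ∀ {Q : Type*} [Finite Q] (δ : Q → A → Q), Nat.card Q = n →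
      (∀ p q, ∃ w : List A, w.foldl δ p = q) →
      (∀ m : ℕ, (∀ (q : Q) (w : List A), w.foldl δ q = q → m ∣ w.length) → m ≤ k) →
      ∃ (π : Q → Equiv.Perm A) (w : List A), (wordImage (recolor δ π) w).ncard ≤ k := by
  induction n using Nat.strong_induction_on with
  | _ n ih =>
    intro Q _ δ hn hconn hk
    by_cases hbranch : ∃ q a b, δ q a ≠ δ q b
    · obtain ⟨π, p, q, hpq, hst⟩ := exists_recolor_stablePair hconn hbranch
      set δ₁ := recolor δ π
      have hlt : Nat.card (Quotient (stableSetoid δ₁)) < n := by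
        rw [← hn]
        refine lt_of_le_of_ne (Nat.card_le_card_of_surjective _ Quotient.mk_surjective) fun h => ?_
        have hbij := (Nat.bijective_iff_surjective_and_card
          (Quotient.mk (stableSetoid δ₁))).2 ⟨Quotient.mk_surjective, h.symm⟩
        exact hpq (hbij.1 (Quotient.sound hst))
      obtain ⟨ρ, w, hw⟩ := ih _ hlt (stableQuotient δ₁) rfl (by
        intro x y
        induction x using Quotient.inductionOn with | _ x
        induction y using Quotient.inductionOn with | _ y
        obtain ⟨w, hw⟩ := exists_foldl_eq_recolor hconn π x y
        exact ⟨w, by rw [foldl_stableQuotient, hw]⟩) (by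
        intro m hm
        -- A cycle of `δ` is a cycle of the recoloring with the same length and projects to the
        -- quotient, so common divisors of the quotient's cycle lengths are common divisors for `δ`.
        refine hk m fun q w hw => ?_
        obtain ⟨w', hlen, hw'⟩ := exists_foldl_recolor (δ := δ) π q w
        rw [← hlen]
        refine hm (Quotient.mk _ q) w' ?_
        rw [foldl_stableQuotient, hw', hw])
      obtain ⟨w', hw'⟩ := exists_ncard_wordImage_liftRecolor_le ρ w
      exact ⟨fun q => (ρ (Quotient.mk _ q)).trans (π q), w', hw'.trans hw⟩
    · push Not at hbranch
      refine ⟨fun _ => 1, [], ?_⟩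
      refine le_trans ?_ (hk (Nat.card Q) fun q w hw => card_dvd_of_forall_eq hconn hbranch hw)
      rw [← Set.ncard_univ]
      exact Set.ncard_le_ncard (Set.subset_univ _) (Set.toFinite _)

end Automata

end RoadColoring

namespace MultiDigraph

open RoadColoring

/-! ### Runs of colorings as runs of automata -/

section Paths

variable {V E C : Type*} {Γ : MultiDigraph V E} {c : E → C}

theorem IsPath.append {p q r : V} {l l' : List E} (h : Γ.IsPath p l q) (h' : Γ.IsPath q l' r) :
    Γ.IsPath p (l ++ l') r := by
  induction l generalizing p with
  | nil =>
    obtain rfl : p = q := h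
    exact h'
  | cons e l ih => exact ⟨h.1, ih h.2⟩

theorem run_nil {p q : V} : Γ.Run c p [] q ↔ p = q := by
  constructor
  · rintro ⟨l, hl, hs⟩
    obtain rfl := List.map_eq_nil_iff.1 hs
    exact hl
  · rintro rfl
    exact ⟨[], rfl, rfl⟩

theorem run_cons {p q : V} {a : C} {s : List C} :
    Γ.Run c p (a :: s) q ↔ ∃ e, Γ.src e = p ∧ c e = a ∧ Γ.Run c (Γ.tgt e) s q := by
  constructor
  · rintro ⟨l, hl, hs⟩
    obtain ⟨e, l, rfl, he, rfl⟩ := List.map_eq_cons_iff.1 hs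
    exact ⟨e, hl.1, he, l, hl.2, rfl⟩
  · rintro ⟨e, he, rfl, l, hl, rfl⟩
    exact ⟨e :: l, ⟨he, hl⟩, rfl⟩

theorem run_append {p r : V} {s t : List C} :
    Γ.Run c p (s ++ t) r ↔ ∃ q, Γ.Run c p s q ∧ Γ.Run c q t r := by
  induction s generalizing p with
  | nil => simp [run_nil]
  | cons a s ih =>
    simp only [List.cons_append, run_cons, ih]
    constructor
    · rintro ⟨e, he, ha, q, hq, hr⟩
      exact ⟨q, ⟨e, he, ha, hq⟩, hr⟩
    · rintro ⟨q, ⟨e, he, ha, hq⟩, hr⟩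
      exact ⟨e, he, ha, q, hq, hr⟩

theorem Deterministic.run_unique (hc : Γ.Deterministic c) {p q q' : V} {s : List C}
    (h : Γ.Run c p s q) (h' : Γ.Run c p s q') : q = q' := by
  induction s generalizing p with
  | nil => exact (run_nil.1 h).symm.trans (run_nil.1 h')
  | cons a s ih =>
    obtain ⟨e, he, hea, h⟩ := run_cons.1 h
    obtain ⟨e', he', hea', h'⟩ := run_cons.1 h'
    obtain rfl := hc e e' (he.trans he'.symm) (hea.trans hea'.symm)
    exact ih h h'

/-- The runs of a complete deterministic coloring are those of its transition function. -/
theorem Deterministic.run_iff (hc : Γ.Deterministic c) {δ : V → C → V}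
    (hδ : ∀ p a, ∃ e, Γ.src e = p ∧ c e = a ∧ Γ.tgt e = δ p a) {p q : V} {s : List C} :
    Γ.Run c p s q ↔ s.foldl δ p = q := by
  induction s generalizing p with
  | nil => exact run_nil
  | cons a s ih =>
    obtain ⟨e, he, ha, ht⟩ := hδ p a
    rw [run_cons, List.foldl_cons, ← ih]
    constructor
    · rintro ⟨f, hf, hfa, h⟩
      obtain rfl := hc e f (he.trans hf.symm) (ha.trans hfa.symm)
      rwa [← ht]
    · intro h
      exact ⟨e, he, ha, ht ▸ h⟩

theorem HasUniformOutdegree.exists_edge {d : ℕ} (h : Γ.HasUniformOutdegree d) (hd : 0 < d)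
    (p : V) : ∃ e, Γ.src e = p := by
  have hne : {e : E | Γ.src e = p}.Nonempty := by
    rw [← Set.encard_ne_zero, h p]
    exact_mod_cast hd.ne'
  exact hne

theorem HasUniformOutdegree.nonempty_equiv {d : ℕ} (h : Γ.HasUniformOutdegree d) (p : V) :
    Nonempty ({e : E | Γ.src e = p} ≃ Fin d) := by
  have hfin : {e : E | Γ.src e = p}.Finite := Set.finite_of_encard_eq_coe (h p)
  have := hfin.to_subtype
  refine ⟨Finite.equivFinOfCardEq ?_⟩
  rw [Nat.card_coe_set_eq, Set.ncard_def, h p, ENat.toNat_natCast]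

/-- A deterministic coloring of a graph of outdegree `d` with `d` colors is complete. -/
theorem Deterministic.exists_edge {d : ℕ} {c : E → Fin d} (hc : Γ.Deterministic c)
    (h : Γ.HasUniformOutdegree d) (p : V) (i : Fin d) : ∃ e, Γ.src e = p ∧ c e = i := by
  obtain ⟨ε⟩ := h.nonempty_equiv p
  have hinj : Function.Injective fun j : Fin d => c (ε.symm j) := fun j j' hj =>
    ε.symm.injective (Subtype.ext (hc _ _
      ((ε.symm j).2.trans (ε.symm j').2.symm) hj))
  obtain ⟨j, hj⟩ := Finite.surjective_of_injective hinj i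
  exact ⟨ε.symm j, (ε.symm j).2, hj⟩

end Paths

/-! ### Residue classes and the strongly connected case -/

section Period

variable {V E C : Type*} {Γ : MultiDigraph V E} {c : E → C} {d k : ℕ}

theorem cycleGcd_dvd_length {p : V} {l : List E} (h : Γ.IsPath p l p) : Γ.cycleGcd ∣ l.length := by
  rcases eq_or_ne l [] with rfl | hl
  · exact dvd_zero _
  · exact Nat.setGcd_dvd_of_mem ⟨p, l, hl, h, rfl⟩

theorem StronglyConnected.cycleGcd_pos (h : Γ.StronglyConnected) (hd : 0 < d)
    (hdeg : Γ.HasUniformOutdegree d) : 0 < Γ.cycleGcd := by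
  obtain ⟨⟨p⟩, hreach⟩ := h
  obtain ⟨e, he⟩ := hdeg.exists_edge hd p
  obtain ⟨l, hl⟩ := hreach (Γ.tgt e) p
  have hdvd := cycleGcd_dvd_length (Γ := Γ) (p := p) (l := e :: l) ⟨he, hl⟩
  exact Nat.pos_of_dvd_of_pos hdvd (by simp)

/-- The residue classes of the vertices modulo the greatest common divisor of the cycle
lengths. -/
theorem StronglyConnected.exists_class (h : Γ.StronglyConnected) :
    ∃ κ : V → ZMod Γ.cycleGcd, ∀ p l q, Γ.IsPath p l q → κ q = κ p + l.length := by
  obtain ⟨⟨p₀⟩, hreach⟩ := h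
  choose l₀ hl₀ using fun q => hreach p₀ q
  refine ⟨fun q => ((l₀ q).length : ZMod Γ.cycleGcd), fun p l q hl => ?_⟩
  -- The same way back closes both paths from `p₀` to `q`, so their lengths agree modulo the gcd.
  obtain ⟨b, hb⟩ := hreach q p₀
  have h1 := cycleGcd_dvd_length ((hl₀ q).append hb)
  have h2 := cycleGcd_dvd_length (((hl₀ p).append hl).append hb)
  rw [← ZMod.natCast_eq_zero_iff] at h1 h2
  simp only [List.length_append, Nat.cast_add] at h1 h2
  linear_combination h1 - h2

theorem HasUniformOutdegree.exists_path (hdeg : Γ.HasUniformOutdegree d) (hd : 0 < d) (n : ℕ)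
    (p : V) : ∃ l q, Γ.IsPath p l q ∧ l.length = n := by
  induction n generalizing p with
  | zero => exact ⟨[], p, rfl, rfl⟩
  | succ n ih =>
    obtain ⟨e, he⟩ := hdeg.exists_edge hd p
    obtain ⟨l, q, hl, hn⟩ := ih (Γ.tgt e)
    exact ⟨e :: l, q, ⟨he, hl⟩, by simp [hn]⟩

/-- No word acting on the vertices has an image with fewer elements than the greatest common
divisor of the cycle lengths. -/
theorem StronglyConnected.cycleGcd_le_encard_image (h : Γ.StronglyConnected) (hd : 0 < d)
    (hdeg : Γ.HasUniformOutdegree d) {s : List C} (hs : Γ.Acts c s) :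
    (Γ.cycleGcd : ℕ∞) ≤ (Γ.image c s).encard := by
  have : NeZero Γ.cycleGcd := ⟨(h.cycleGcd_pos hd hdeg).ne'⟩
  obtain ⟨κ, hκ⟩ := h.exists_class
  obtain ⟨p₀⟩ := h.1
  have hsurj : κ '' Γ.image c s = Set.univ := by
    refine Set.eq_univ_of_forall fun r => ?_
    obtain ⟨l, p, hl, hlen⟩ := hdeg.exists_path hd (r - s.length - κ p₀).val p₀
    obtain ⟨q, l', hl', hs'⟩ := hs p
    refine ⟨q, ⟨p, l', hl', hs'⟩, ?_⟩
    have hlen' : l'.length = s.length := by rw [← hs', List.length_map]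
    rw [hκ _ _ _ hl', hκ _ _ _ hl, hlen, hlen', ZMod.natCast_zmod_val]
    ring
  calc (Γ.cycleGcd : ℕ∞) = (Set.univ : Set (ZMod Γ.cycleGcd)).encard := by
        rw [Set.encard_univ, ENat.card_eq_coe_fintype_card, ZMod.card]
    _ ≤ (Γ.image c s).encard := hsurj ▸ Set.encard_image_le κ _

/-- The periodic road coloring theorem: a strongly connected graph of constant outdegree `d` has a
`k`-synchronizing coloring with `d` colors, `k` being the greatest common divisor of its cycle
lengths. -/
theorem StronglyConnected.exists_isSynchronizingColoring [Finite V] (h : Γ.StronglyConnected)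
    (hd : 0 < d) (hdeg : Γ.HasUniformOutdegree d) :
    ∃ c : E → Fin d, Γ.IsSynchronizingColoring c Γ.cycleGcd := by
  have hpos := h.cycleGcd_pos hd hdeg
  have : Nonempty (Fin d) := ⟨⟨0, hd⟩⟩
  have ε : ∀ p, {e : E | Γ.src e = p} ≃ Fin d := fun p => (hdeg.nonempty_equiv p).some
  have hsrc : ∀ p i, Γ.src ((ε p).symm i) = p := fun p i => ((ε p).symm i).2
  have hε : ∀ p i (hp : Γ.src ((ε p).symm i) = Γ.src ((ε p).symm i)),
      ε (Γ.src ((ε p).symm i)) ⟨(ε p).symm i, hp⟩ = i := by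
    intro p i
    have key : ∀ (q : V) (e : E) (hq : Γ.src e = q) (hq' : Γ.src e = Γ.src e),
        ε (Γ.src e) ⟨e, hq'⟩ = ε q ⟨e, hq⟩ := by
      rintro _ e rfl _
      rfl
    intro hp
    rw [key p _ (hsrc p i)]
    exact (ε p).apply_symm_apply i
  set δ : V → Fin d → V := fun p i => Γ.tgt ((ε p).symm i)
  have hcol : ∀ π : V → Equiv.Perm (Fin d), ∃ c : E → Fin d, Γ.Deterministic c ∧
      ∀ p i, ∃ e, Γ.src e = p ∧ c e = i ∧ Γ.tgt e = recolor δ π p i := by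
    intro π
    refine ⟨fun e => (π (Γ.src e)).symm (ε (Γ.src e) ⟨e, rfl⟩), fun e f hef hc => ?_,
      fun p i => ⟨(ε p).symm (π p i), hsrc _ _, ?_, rfl⟩⟩
    · have key : ∀ (q : V) (hq : Γ.src f = q), (π q).symm (ε q ⟨f, hq⟩) =
          (π (Γ.src f)).symm (ε (Γ.src f) ⟨f, rfl⟩) := by
        rintro _ rfl
        rfl
      have h1 := hc.trans (key (Γ.src e) hef.symm).symm
      exact congrArg Subtype.val ((ε _).injective ((π _).symm.injective h1))
    · show (π (Γ.src ((ε p).symm (π p i)))).symm (ε _ ⟨(ε p).symm (π p i), rfl⟩) = i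
      rw [hε, hsrc, Equiv.symm_apply_apply]
  obtain ⟨c₁, hc₁, hc₁'⟩ := hcol fun _ => 1
  have hrun : ∀ p q (w : List (Fin d)), Γ.Run c₁ p w q ↔ w.foldl δ p = q := fun p q w =>
    hc₁.run_iff hc₁'
  obtain ⟨π, w, hw⟩ := exists_recolor_ncard_wordImage_le (k := Γ.cycleGcd) _ δ rfl
    (fun p q => by
      obtain ⟨l, hl⟩ := h.2 p q
      exact ⟨l.map c₁, (hrun p q _).1 ⟨l, hl, rfl⟩⟩)
    (fun m hm => Nat.le_of_dvd hpos (Nat.dvd_setGcd_iff.2 (by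
      rintro _ ⟨p, l, -, hl, rfl⟩
      simpa using hm p (l.map c₁) ((hrun p p _).1 ⟨l, hl, rfl⟩))))
  obtain ⟨c, hc, hc'⟩ := hcol π
  have hacts : ∀ s : List (Fin d), Γ.Acts c s := fun s p => ⟨_, (hc.run_iff hc').2 rfl⟩
  have himage : ∀ s : List (Fin d), Γ.image c s = wordImage (recolor δ π) s := fun s => by
    ext q
    simp only [image, wordImage, Set.mem_ofPred_eq, Set.mem_range, hc.run_iff hc']
  have hlow := fun s => h.cycleGcd_le_encard_image hd hdeg (hacts s)
  -- The additional letter only makes the word nonempty.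
  refine ⟨c, hc, w ++ [⟨0, hd⟩], by simp, hacts _, le_antisymm ?_ (hlow _), fun t _ => hlow t⟩
  rw [himage, ← (Set.toFinite _).cast_ncard_eq]
  exact_mod_cast (ncard_wordImage_append_le w _).trans hw

end Period

end MultiDigraph

namespace MultiDigraph

/-! ### Extension from the sink component to the whole graph -/

section Extension

variable {V E : Type*} {Γ : MultiDigraph V E} {S : Set V} {F : Set E}
  {hF : ∀ e ∈ F, Γ.src e ∈ S ∧ Γ.tgt e ∈ S} {d k : ℕ}

/-- A choice, at every vertex outside `S`, of an edge on a shortest path to `S`. -/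
theorem exists_edges_towards (h : ∀ p : V, ∃ q ∈ S, Γ.Reachable p q) :
    ∃ (T : Set E) (D : V → ℕ), (∀ p ∉ S, ∃ e ∈ T, Γ.src e = p ∧ D (Γ.tgt e) < D p) ∧
      (∀ e ∈ T, Γ.src e ∉ S) ∧ ∀ e ∈ T, ∀ f ∈ T, Γ.src e = Γ.src f → e = f := by
  classical
  have hex : ∀ p, ∃ n, ∃ q ∈ S, ∃ l, Γ.IsPath p l q ∧ l.length = n := fun p => by
    obtain ⟨q, hq, l, hl⟩ := h p
    exact ⟨l.length, q, hq, l, hl, rfl⟩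
  have hstep : ∀ p, p ∉ S → ∃ e, Γ.src e = p ∧ Nat.find (hex (Γ.tgt e)) < Nat.find (hex p) := by
    intro p hp
    obtain ⟨q, hq, l, hl, hlen⟩ := Nat.find_spec (hex p)
    cases l with
    | nil =>
      obtain rfl : p = q := hl
      exact absurd hq hp
    | cons e l =>
      refine ⟨e, hl.1, ?_⟩
      rw [← hlen, List.length_cons, Nat.lt_succ_iff]
      exact Nat.find_min' _ ⟨q, hq, l, hl.2, rfl⟩
  choose t ht hlt using hstep
  refine ⟨{e | ∃ (p : V) (hp : p ∉ S), e = t p hp}, fun p => Nat.find (hex p),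
    fun p hp => ⟨t p hp, ⟨p, hp, rfl⟩, ht p hp, hlt p hp⟩, ?_, ?_⟩
  · rintro _ ⟨p, hp, rfl⟩
    rwa [ht p hp]
  · rintro _ ⟨p, hp, rfl⟩ _ ⟨q, hq, rfl⟩ hpq
    rw [ht p hp, ht q hq] at hpq
    subst hpq
    rfl

/-- `c` extends the coloring `c₂` of the subgraph on `S` and `F`, using colors of `c₂` on no further
edge that starts in `S` and every color not less than `d` at most once. -/
structure IsSparseExtension (Γ : MultiDigraph V E) (S : Set V) (F : Set E) (c₂ : F → Fin d)
    (c : E → ℕ) : Prop where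
  eq : ∀ e : F, c e = c₂ e
  mem : ∀ e, Γ.src e ∈ S → c e < d → e ∈ F
  unique : ∀ e f, d ≤ c e → c e = c f → e = f

/-- Coloring the chosen edges outside `S` by `0` and the other new edges by new colors. -/
theorem exists_isSparseExtension [Countable E] (hd : 0 < d)
    (hF : ∀ e ∈ F, Γ.src e ∈ S ∧ Γ.tgt e ∈ S)
    (c₂ : F → Fin d) (hc₂ : (Γ.subgraph S F hF).Deterministic c₂) {T : Set E}
    (hTS : ∀ e ∈ T, Γ.src e ∉ S) (hT : ∀ e ∈ T, ∀ f ∈ T, Γ.src e = Γ.src f → e = f) :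
    ∃ c : E → ℕ, Γ.IsSparseExtension S F c₂ c ∧ Γ.Deterministic c ∧ ∀ e ∈ T, c e = 0 := by
  classical
  obtain ⟨ι, hι⟩ := Countable.exists_injective_nat E
  set c : E → ℕ := fun e => if h : e ∈ F then (c₂ ⟨e, h⟩ : ℕ) else if e ∈ T then 0 else d + ι e
  have hcF : ∀ e (h : e ∈ F), c e = c₂ ⟨e, h⟩ := fun e h => dif_pos h
  have hTF : ∀ e ∈ T, e ∉ F := fun e he h => hTS e he (hF e h).1
  have hcT : ∀ e ∈ T, c e = 0 := fun e he => by
    simp only [c, dif_neg (hTF e he), if_pos he]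
  have hcnew : ∀ e, e ∉ F → e ∉ T → c e = d + ι e := fun e h h' => by
    simp only [c, dif_neg h, if_neg h']
  have hge : ∀ e, d ≤ c e → c e = d + ι e := by
    intro e he
    by_cases h : e ∈ F
    · rw [hcF e h] at he
      exact absurd (c₂ ⟨e, h⟩).2 (not_lt.2 he)
    · refine hcnew e h fun h' => ?_
      rw [hcT e h'] at he
      omega
  have hlt : ∀ e, c e < d → e ∉ F → e ∈ T := by
    intro e he hF
    by_contra hno
    rw [hcnew e hF hno] at he
    omega
  have hunique : ∀ e f, d ≤ c e → c e = c f → e = f := by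
    intro e f he hef
    have h1 := hge e he
    have h2 := hge f (hef ▸ he)
    exact hι (by omega)
  refine ⟨c, ⟨fun e => hcF e e.2, fun e he hed => ?_, hunique⟩, fun e f hsrc hef => ?_, hcT⟩
  · by_contra hno
    exact hTS e (hlt e hed hno) he
  · rcases Nat.lt_or_ge (c e) d with hed | hed
    · by_cases he : e ∈ F
      · have hf : f ∈ F := by
          by_contra hno
          exact hTS f (hlt f (hef ▸ hed) hno) (hsrc ▸ (hF e he).1)
        rw [hcF e he, hcF f hf] at hef
        exact congrArg Subtype.val (hc₂ ⟨e, he⟩ ⟨f, hf⟩ (Subtype.ext hsrc) (Fin.ext hef))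
      · have hf : f ∉ F := fun h => hTS e (hlt e hed he) (hsrc ▸ (hF f h).1)
        exact hT e (hlt e hed he) f (hlt f (hef ▸ hed) hf) hsrc
    · exact hunique e f hed hef

namespace IsSparseExtension

variable {c₂ : F → Fin d} {c : E → ℕ} (h : Γ.IsSparseExtension S F c₂ c)
include h

/-- At a vertex of `S` old colors occur only on edges of `F`, and these stay in `S`. -/
theorem run_iff {p : S} {s : List (Fin d)} {q : V} :
    Γ.Run c p (s.map (↑)) q ↔ ∃ q' : S, (q' : V) = q ∧ (Γ.subgraph S F hF).Run c₂ p s q' := by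
  induction s generalizing p with
  | nil =>
    simp only [List.map_nil, run_nil]
    exact ⟨fun h => ⟨p, h, rfl⟩, fun ⟨q', hq', h⟩ => h ▸ hq'⟩
  | cons a s ih =>
    simp only [List.map_cons, run_cons]
    constructor
    · rintro ⟨e, he, ha, hrun⟩
      have heF : e ∈ F := h.mem e (he ▸ p.2) (ha ▸ a.2)
      obtain ⟨q', hq', hrun'⟩ := (ih (p := (Γ.subgraph S F hF).tgt ⟨e, heF⟩)).1 hrun
      refine ⟨q', hq', ⟨e, heF⟩, Subtype.ext he, Fin.ext ?_, hrun'⟩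
      rw [← ha, h.eq ⟨e, heF⟩]
    · rintro ⟨q', hq', e, he, ha, hrun⟩
      exact ⟨e, congrArg Subtype.val he, by rw [h.eq e, ha], ih.2 ⟨q', hq', hrun⟩⟩

theorem acts_subgraph {s : List (Fin d)} (hs : Γ.Acts c (s.map (↑))) :
    (Γ.subgraph S F hF).Acts c₂ s := fun p => by
  obtain ⟨q, hq⟩ := hs p
  obtain ⟨q', -, hq'⟩ := h.run_iff.1 hq
  exact ⟨q', hq'⟩

theorem encard_image_subgraph_le (s : List (Fin d)) :
    ((Γ.subgraph S F hF).image c₂ s).encard ≤ (Γ.image c (s.map (↑))).encard := by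
  rw [← Subtype.val_injective.encard_image ((Γ.subgraph S F hF).image c₂ s)]
  apply Set.encard_le_encard
  rintro _ ⟨q, ⟨p, hp⟩, rfl⟩
  exact ⟨p, h.run_iff.2 ⟨q, rfl, hp⟩⟩

end IsSparseExtension

/-- A list of numbers consists of numbers below `d`, up to the first exception. -/
theorem exists_map_val_or (d : ℕ) (t : List ℕ) :
    (∃ s : List (Fin d), t = s.map (↑)) ∨
      ∃ (s : List (Fin d)) (x : ℕ) (w : List ℕ), d ≤ x ∧ t = s.map (↑) ++ x :: w := by
  induction t with
  | nil => exact Or.inl ⟨[], rfl⟩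
  | cons a t ih =>
    rcases Nat.lt_or_ge a d with ha | ha
    · rcases ih with ⟨s, rfl⟩ | ⟨s, x, w, hx, rfl⟩
      · exact Or.inl ⟨⟨a, ha⟩ :: s, rfl⟩
      · exact Or.inr ⟨⟨a, ha⟩ :: s, x, w, hx, rfl⟩
    · exact Or.inr ⟨[], a, t, ha, rfl⟩

/-- Old words act on `S` as in the subgraph. Otherwise the first new color `x` labels a single edge,
so the prefix before it sends every vertex to the source of this edge; the bound for the prefix then
gives `k ≤ 1`. -/
theorem IsSparseExtension.le_encard_image [Nonempty V] {c₂ : F → Fin d} {c : E → ℕ}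
    (h : Γ.IsSparseExtension S F c₂ c) (hc : Γ.Deterministic c)
    (hk : ∀ s, (Γ.subgraph S F hF).Acts c₂ s →
      (k : ℕ∞) ≤ ((Γ.subgraph S F hF).image c₂ s).encard)
    {t : List ℕ} (ht : Γ.Acts c t) : (k : ℕ∞) ≤ (Γ.image c t).encard := by
  rcases exists_map_val_or d t with ⟨s, rfl⟩ | ⟨s, x, w, hx, rfl⟩
  · exact (hk s (h.acts_subgraph ht)).trans (h.encard_image_subgraph_le s)
  · have hs : Γ.Acts c (s.map (↑)) := fun p => by
      obtain ⟨r, hr⟩ := ht p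
      obtain ⟨q, hq, -⟩ := run_append.1 hr
      exact ⟨q, hq⟩
    have hedge : ∀ q ∈ Γ.image c (s.map (↑)), ∃ e, Γ.src e = q ∧ c e = x := by
      rintro q ⟨p, hq⟩
      obtain ⟨r, hr⟩ := ht p
      obtain ⟨q', hq', hr'⟩ := run_append.1 hr
      obtain rfl := hc.run_unique hq hq'
      obtain ⟨e, he, hex, -⟩ := run_cons.1 hr'
      exact ⟨e, he, hex⟩
    have hone : (Γ.image c (s.map (↑))).encard ≤ 1 := by
      rw [Set.encard_le_one_iff]
      intro q q' hq hq'
      obtain ⟨e, rfl, he⟩ := hedge q hq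
      obtain ⟨e', rfl, he'⟩ := hedge q' hq'
      rw [h.unique e e' (he ▸ hx) (he.trans he'.symm)]
    have hne : (Γ.image c (s.map (↑) ++ x :: w)).Nonempty := by
      obtain ⟨p⟩ := ‹Nonempty V›
      obtain ⟨r, hr⟩ := ht p
      exact ⟨r, p, hr⟩
    exact (((hk s (h.acts_subgraph hs)).trans (h.encard_image_subgraph_le s)).trans hone).trans
      (Set.one_le_encard_iff_nonempty.2 hne)

/-- If the chosen edges towards `S` have the color `0`, long powers of `0` lead into `S`. -/
theorem IsSparseExtension.exists_run_replicate {c₂ : F → Fin d} {c : E → ℕ}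
    (h : Γ.IsSparseExtension S F c₂ c) (hd : 0 < d) (hc₂ : (Γ.subgraph S F hF).Deterministic c₂)
    (hdeg : (Γ.subgraph S F hF).HasUniformOutdegree d) {D : V → ℕ}
    (hD : ∀ p ∉ S, ∃ e, Γ.src e = p ∧ c e = 0 ∧ D (Γ.tgt e) < D p) (n : ℕ) :
    ∀ p, D p ≤ n → ∃ q ∈ S, Γ.Run c p (List.replicate n 0) q := by
  -- `c₂` is complete, so vertices that are already in `S` can go on reading 0 there while the
  -- others arrive.
  have hS : ∀ p ∈ S, ∃ e, Γ.src e = p ∧ c e = 0 ∧ Γ.tgt e ∈ S := by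
    intro p hp
    obtain ⟨e, he, he0⟩ := hc₂.exists_edge hdeg ⟨p, hp⟩ ⟨0, hd⟩
    exact ⟨e, congrArg Subtype.val he, by rw [h.eq e, he0], (hF e e.2).2⟩
  have hin : ∀ n, ∀ p ∈ S, ∃ q ∈ S, Γ.Run c p (List.replicate n 0) q := by
    intro n
    induction n with
    | zero => exact fun p hp => ⟨p, hp, run_nil.2 rfl⟩
    | succ n ih =>
      intro p hp
      obtain ⟨e, he, he0, ht⟩ := hS p hp
      obtain ⟨q, hq, hrun⟩ := ih _ ht
      exact ⟨q, hq, run_cons.2 ⟨e, he, he0, hrun⟩⟩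
  induction n with
  | zero =>
    intro p hp
    refine hin 0 p ?_
    by_contra hpS
    obtain ⟨e, -, -, hlt⟩ := hD p hpS
    omega
  | succ n ih =>
    intro p hp
    by_cases hpS : p ∈ S
    · exact hin _ p hpS
    · obtain ⟨e, he, he0, hlt⟩ := hD p hpS
      obtain ⟨q, hq, hrun⟩ := ih (Γ.tgt e) (by omega)
      exact ⟨q, hq, run_cons.2 ⟨e, he, he0, hrun⟩⟩

/-- A `k`-synchronizing coloring of a spanning subgraph of constant outdegree of the sink component
extends to the whole graph. -/
theorem exists_extension_isSynchronizingColoring [Finite V] [Countable E] [Nonempty V]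
    (hreach : ∀ p : V, ∃ q ∈ S, Γ.Reachable p q) (hd : 0 < d)
    (hdeg : (Γ.subgraph S F hF).HasUniformOutdegree d) {c₂ : F → Fin d}
    (hc₂ : (Γ.subgraph S F hF).IsSynchronizingColoring c₂ k) :
    ∃ c : E → ℕ, (∀ e : F, c e = c₂ e) ∧ Γ.IsSynchronizingColoring c k := by
  obtain ⟨hdet₂, s, hne, hacts, hcard, hmin⟩ := hc₂
  obtain ⟨T, D, hTD, hTS, hT⟩ := exists_edges_towards hreach
  obtain ⟨c, h, hdet, hcT⟩ := exists_isSparseExtension hd hF c₂ hdet₂ hTS hT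
  -- One exponent `m` for all vertices, so that a single power of 0 takes the whole graph into `S`.
  obtain ⟨m, hm⟩ := (Set.finite_range D).bddAbove
  have hpow : ∀ p, ∃ q ∈ S, Γ.Run c p (List.replicate m 0) q := fun p =>
    h.exists_run_replicate hd hdet₂ hdeg (fun p hp => by
      obtain ⟨e, he, hsrc, hlt⟩ := hTD p hp
      exact ⟨e, hsrc, hcT e he, hlt⟩) m p (hm ⟨p, rfl⟩)
  set t : List ℕ := List.replicate m 0 ++ s.map (↑)
  have ht : Γ.Acts c t := fun p => by
    obtain ⟨q, hq, hrun⟩ := hpow p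
    obtain ⟨r, hr⟩ := hacts ⟨q, hq⟩
    exact ⟨r, run_append.2 ⟨q, hrun, (h.run_iff (p := ⟨q, hq⟩)).2 ⟨r, rfl, hr⟩⟩⟩
  have hlow := fun t (ht : Γ.Acts c t) => h.le_encard_image hdet hmin ht
  refine ⟨c, h.eq, hdet, t, by simpa [t] using fun _ => hne, ht, le_antisymm ?_ (hlow t ht), hlow⟩
  rw [← hcard, ← Subtype.val_injective.encard_image ((Γ.subgraph S F hF).image c₂ s)]
  apply Set.encard_le_encard
  rintro r ⟨p, hp⟩
  obtain ⟨q, hrun, hr⟩ := run_append.1 hp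
  obtain ⟨q', hq', hrun'⟩ := hpow p
  obtain rfl := hdet.run_unique hrun hrun'
  obtain ⟨r', rfl, hr'⟩ := (h.run_iff (p := ⟨q, hq'⟩)).1 hr
  exact ⟨r', ⟨_, hr'⟩, rfl⟩

end Extension

end MultiDigraph

theorem mainTheorem5 {V E : Type*} [Finite V] [Finite E] (Γ : MultiDigraph V E)
    (S : Set V) (hS : Γ.IsSinkComponent S)
    (F : Set E) (hF : ∀ e ∈ F, Γ.src e ∈ S ∧ Γ.tgt e ∈ S)
    (hconn : (Γ.subgraph S F hF).StronglyConnected)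
    (d : ℕ) (hd : 0 < d) (hdeg : (Γ.subgraph S F hF).HasUniformOutdegree d)
    (k : ℕ) (hk : (Γ.subgraph S F hF).cycleGcd = k) :
    (∃ c₂ : F → Fin d, (Γ.subgraph S F hF).IsSynchronizingColoring c₂ k) ∧
      ∀ c₂ : F → Fin d, (Γ.subgraph S F hF).IsSynchronizingColoring c₂ k →
        ∃ c : E → ℕ, (∀ e : F, c e = c₂ e) ∧ Γ.IsSynchronizingColoring c k := by
  have : Nonempty V := hconn.1.map Subtype.val
  exact ⟨hk ▸ hconn.exists_isSynchronizingColoring hd hdeg,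
    fun c₂ hc₂ => MultiDigraph.exists_extension_isSynchronizingColoring hS.2.2 hd hdeg hc₂⟩
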